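/- Let $n,k,r$ be nonnegative integers with $r\le n$, and let $[n]=\{1,\dots,n\}$. Let $I_{n,k,r}\subseteq\mathbb{Q}[x_1,\dots,x_n]$ be the ideal $$I_{n,k,r}=\langle h_{k+1},h_{k+2},\dots,h_{k+n},\ e_n,e_{n-1},\dots,e_{n-r+1}\rangle ,$$ where $h_d$ and $e_d$ are the complete homogeneous and elementary symmetric polynomials of degree $d$ in $x_1,\dots,x_n$, and let $R_{n,k,r}=\mathbb{Q}[x_1,\dots,x_n]/I_{n,k,r}$. Order monomials lexicographically with $x_1>x_2>\cdots>x_n$. The standard monomial basis of $R_{n,k,r}$ is the set of all monomials that are not divisible by the leading term of any nonzero element of $I_{n,k,r}$. For $S=\{s_1<\cdots<s_m\}\subseteq[n]$ put $\mathbf{x}(S)=x_{s_1}^{s_1}x_{s_2}^{s_2-1}\cdots x_{s_m}^{s_m-m+1}$, and let $\mathcal{M}_{n,k,r}$ be the set of monomials $m$ such that $\mathbf{x}(S)\nmid m$ for all $S\subseteq[n]$ with $|S|=n-r+1$ and $x_i^{k+i}\nmid m$ for all $1\le i\le n$. For an $(n-r)$-element subset $T\subseteq[n]$ with $[n]\setminus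 T=\{s_1<\cdots<s_r\}$, define the $(n,k,r)$-staircase $\delta(T)=(\delta(T)_1,\dots,\delta(T)_n)$ by $\delta(T)_i=i+k-1$ if $i\in T$ and $\delta(T)_{s_j}=j-1$ for $1\le j\le r$. Then the standard monomial basis of $R_{n,k,r}$ is equal to $\mathcal{M}_{n,k,r}$, and it consists exactly of the monomials $x_1^{a_1}\cdots x_n^{a_n}$ whose exponent vector satisfies $(a_1,\dots,a_n)\le\delta(T)$ componentwise for at least one $(n-r)$-element subset $T\subseteq[n]$. -/

import Mathlib

namespace TailPositive

open MvPolynomial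

noncomputable section

/-- The variable `x_i` of `ℚ[x_1, …, x_n]` is `X ⟨i - 1, _⟩`: an index `i : Fin n` stands for the
element `i + 1` of `[n] = {1, …, n}`. -/
abbrev Poly (n : ℕ) : Type := MvPolynomial (Fin n) ℚ

/-- The monomial `x_1 ^ a_1 ⋯ x_n ^ a_n` with exponent vector `a`. -/
abbrev mon {n : ℕ} (a : Fin n →₀ ℕ) : Poly n := monomial a 1

/-- The ideal generated by `h_{k+1}, …, h_{k+n}` and `e_n, e_{n-1}, …, e_{n-r+1}`. -/
def idealI (n k r : ℕ) : Ideal (Poly n) :=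
  Ideal.span
    ((fun d => hsymm (Fin n) ℚ d) '' Set.Icc (k + 1) (k + n) ∪
      (fun d => esymm (Fin n) ℚ d) '' Set.Icc (n - r + 1) n)

/-- The standard monomial basis of `ℚ[x_1, …, x_n] / I` for the lexicographic order
(`x_1 > ⋯ > x_n`), given by exponent vectors: the monomials that are divisible by the leading term
of no nonzero element of `I`. -/
def standardMonomials {n : ℕ} (I : Ideal (Poly n)) : Set (Fin n →₀ ℕ) :=
  {a | ∀ f ∈ I, f ≠ 0 → ¬ MonomialOrder.lex.leadingTerm f ∣ mon a}

/-- The skip monomial `x(S) = x_{s_1}^{s_1} x_{s_2}^{s_2 - 1} ⋯ x_{s_m}^{s_m - m + 1}` for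
`S = {s_1 < ⋯ < s_m}`; the exponent of `x_{s_j}` is `s_j - #{s ∈ S | s < s_j}`. -/
def skipMonomial {n : ℕ} (S : Finset (Fin n)) : Poly n :=
  ∏ i ∈ S, X i ^ ((i : ℕ) + 1 - (S.filter (· < i)).card)

/-- The `(n,k,r)`-good monomials, given by exponent vectors. -/
def goodMonomials (n k r : ℕ) : Set (Fin n →₀ ℕ) :=
  {a | (∀ S : Finset (Fin n), S.card = n - r + 1 → ¬ skipMonomial S ∣ mon a) ∧
    ∀ i : Fin n, ¬ (X i ^ (k + ((i : ℕ) + 1)) : Poly n) ∣ mon a}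

/-- The sequence `δ(T)`: its entry at `i ∈ T` is `i + k - 1`, and its entry at the `j`-th smallest
element of `[n] - T` is `j - 1`, the number of smaller elements of `[n] - T`. -/
def staircase {n : ℕ} (k : ℕ) (T : Finset (Fin n)) (i : Fin n) : ℕ :=
  if i ∈ T then ((i : ℕ) + 1) + k - 1 else (Tᶜ.filter (· < i)).card

/-- The exponent vectors that are componentwise at most some `(n,k,r)`-staircase. -/
def subStaircaseMonomials (n k r : ℕ) : Set (Fin n →₀ ℕ) :=
  {a | ∃ T : Finset (Fin n), T.card = n - r ∧ ∀ i, a i ≤ staircase k T i}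

theorem mem_standardMonomials_iff {n : ℕ} (I : Ideal (Poly n)) (a : Fin n →₀ ℕ) :
    a ∈ standardMonomials I ↔ ∀ f ∈ I, f ≠ 0 → ¬ MonomialOrder.lex.degree f ≤ a := by
  refine forall_congr' fun f => forall_congr' fun _ => forall_congr' fun h0 => ?_
  have hu : IsUnit (MonomialOrder.lex.leadingCoeff f) :=
    isUnit_iff_ne_zero.2 (MonomialOrder.leadingCoeff_ne_zero_iff.2 h0)
  rw [MonomialOrder.leadingTerm, monomial_dvd_monomial]
  simp [h0]

/-- The standard monomials of an ideal descend to a vector space basis of the quotient. -/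
theorem standardMonomials_basis {n : ℕ} (I : Ideal (Poly n)) :
    LinearIndependent ℚ (fun a : standardMonomials I => Ideal.Quotient.mk I (mon a.1)) ∧
    Submodule.span ℚ (Set.range
      (fun a : standardMonomials I => Ideal.Quotient.mk I (mon a.1))) = ⊤ := by
  constructor
  · rw [linearIndependent_iff]
    intro l hl
    by_contra hne
    let f : Poly n := Finsupp.linearCombination ℚ (fun a : standardMonomials I => mon a.1) l
    have hc : ∀ a : standardMonomials I, coeff a.1 f = l a := by
      intro a
      simp only [f, Finsupp.linearCombination_apply, Finsupp.sum, coeff_sum, coeff_smul,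
        coeff_monomial, smul_eq_mul]
      rw [Finset.sum_eq_single a]
      · simp
      · intro b _ hb
        rw [if_neg fun h => hb (Subtype.ext h), mul_zero]
      · intro h
        simp [Finsupp.notMem_support_iff.1 h]
    have hs : ∀ b, b ∉ standardMonomials I → coeff b f = 0 := by
      intro b hb
      simp only [f, Finsupp.linearCombination_apply, Finsupp.sum, coeff_sum, coeff_smul,
        coeff_monomial, smul_eq_mul]
      refine Finset.sum_eq_zero fun a _ => ?_
      rw [if_neg, mul_zero]
      rintro rfl
      exact hb a.2
    have hf0 : f ≠ 0 := by
      intro h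
      apply hne
      ext a
      rw [← hc, h]; simp
    have hfI : f ∈ I := by
      rw [← Ideal.Quotient.eq_zero_iff_mem, ← hl]
      simp only [f, Finsupp.linearCombination_apply, Finsupp.sum, map_sum]
      refine Finset.sum_congr rfl fun a _ => ?_
      exact map_smul (Ideal.Quotient.mkₐ ℚ I) (l a) (mon a.1)
    have hd : MonomialOrder.lex.degree f ∉ standardMonomials I := fun h =>
      (mem_standardMonomials_iff I _).1 h f hfI hf0 le_rfl
    exact MonomialOrder.leadingCoeff_ne_zero_iff.2 hf0 (hs _ hd)
  · rw [eq_top_iff]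
    rintro x -
    obtain ⟨f, rfl⟩ := Ideal.Quotient.mk_surjective x
    obtain ⟨g, p, hfg, -, hp⟩ := MonomialOrder.lex.div_set (B := {b : Poly n | b ∈ I ∧ b ≠ 0})
      (fun b hb => isUnit_iff_ne_zero.2 (MonomialOrder.leadingCoeff_ne_zero_iff.2 hb.2)) f
    have h1 : Ideal.Quotient.mk I f = Ideal.Quotient.mk I p := by
      rw [Ideal.Quotient.eq, hfg, add_sub_cancel_right, Finsupp.linearCombination_apply]
      exact Ideal.sum_mem _ fun b _ => I.mul_mem_left _ b.2.1
    rw [h1, p.as_sum, map_sum]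
    refine Submodule.sum_mem _ fun c hcs => ?_
    have hc : c ∈ standardMonomials I :=
      (mem_standardMonomials_iff I c).2 fun b hb h0 => hp c hcs b ⟨hb, h0⟩
    have h2 : Ideal.Quotient.mk I (monomial c (coeff c p)) =
        coeff c p • Ideal.Quotient.mk I (mon c) := by
      have := map_smul (Ideal.Quotient.mkₐ ℚ I) (coeff c p) (mon c)
      rw [smul_monomial, smul_eq_mul, mul_one] at this
      exact this
    rw [h2]
    exact Submodule.smul_mem _ _ (Submodule.subset_span ⟨⟨c, hc⟩, rfl⟩)

end

end TailPositive

namespace TailPositive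

open MvPolynomial

/-! The three sets are tied by a cycle of inclusions: standard ⊆ good ⊆ below a staircase ⊆
standard.

Standard ⊆ good: the ideal contains elements with the forbidden leading monomials. For `x_i ^ (k +
i)` this is `h_{k+i}(x_i, …, x_n)`. For skip monomials, an induction on the number of variables
passes through minors of matrices `(e_{D_j - l})`: stripping off `x_1` shifts the columns if `x_1`
is used by `S`, and otherwise changes the size of the minors by one
(`exists_degree_eq_skipExponent`).

Good ⊆ below a staircase: scan the indices in increasing order and accept `i` when `a_i` is at most
the number of indices accepted so far. More than `n - r` rejections would produce a skip monomial
dividing the given one, so at least `r` indices are accepted, and the first `r` of them form the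
complement of `T`.

Below a staircase ⊆ standard: deform the ideal to a finite set of points. Take `L ⊆ A ⊆ ℚ` with `|A|
= n + k`, `|L| = r`, and let `Y` be the set of injective words of length `n` in `A` that use all of
`L`. Generating functions show that each generator is the top-degree part of a polynomial vanishing
on `Y`. A nonzero polynomial supported below staircases cannot vanish on `Y`
(`eq_zero_of_eval_pointLocus`), and this passes from the vanishing ideal to `idealI`
(`eq_zero_of_mem_of_support_subset`). Hence the monomials below staircases are independent modulo
the ideal; the standard ones among them already span, so all are standard. -/

theorem finSuccEquiv_rename_succ {n : ℕ} (p : Poly n) :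
    finSuccEquiv ℚ n (rename Fin.succ p) = Polynomial.C p := by
  induction p using MvPolynomial.induction_on with
  | C a => rw [rename_C, finSuccEquiv_apply]; simp
  | add p q hp hq => simp [hp, hq]
  | mul_X p i hp => simp [hp, finSuccEquiv_X_succ]

/-! ### Recursions for `h_d` and `e_d` in the first variable -/

theorem hsymm_option_succ {σ : Type*} [Fintype σ] [DecidableEq σ] (d : ℕ) :
    hsymm (Option σ) ℚ (d + 1) =
      X none * hsymm (Option σ) ℚ d + rename some (hsymm σ ℚ (d + 1)) := by
  unfold hsymm
  -- Multisets of size `d + 1` are split by whether they contain `none`.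
  rw [← Equiv.sum_comp (symOptionSuccEquiv (α := σ) (n := d)).symm, Fintype.sum_sum_type,
    Finset.mul_sum, map_sum]
  congr 1
  · refine Finset.sum_congr rfl fun s _ => ?_
    change (Multiset.map X (SymOptionSuccEquiv.decode (Sum.inl s)).1).prod = _
    rw [SymOptionSuccEquiv.decode_inl]
    change (Multiset.map X (none ::ₘ s.1)).prod = _
    rw [Multiset.map_cons, Multiset.prod_cons]
  · refine Finset.sum_congr rfl fun s _ => ?_
    change (Multiset.map X (SymOptionSuccEquiv.decode (Sum.inr s)).1).prod = _
    rw [SymOptionSuccEquiv.decode_inr, map_multiset_prod]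
    change (Multiset.map X (Multiset.map _ s.1)).prod = (Multiset.map _ (Multiset.map X s.1)).prod
    rw [Multiset.map_map, Multiset.map_map]
    refine congrArg Multiset.prod (Multiset.map_congr rfl fun i _ => ?_)
    simp

theorem hsymm_succ (n d : ℕ) :
    hsymm (Fin (n + 1)) ℚ (d + 1) =
      X 0 * hsymm (Fin (n + 1)) ℚ d + rename Fin.succ (hsymm (Fin n) ℚ (d + 1)) := by
  have h := congrArg (rename (finSuccEquiv' (0 : Fin (n + 1))).symm)
    (hsymm_option_succ (σ := Fin n) d)
  rw [rename_hsymm, map_add, map_mul, rename_hsymm, rename_X, rename_rename] at h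
  rw [h]
  congr 2

theorem hsymm_fin_zero_succ (d : ℕ) : hsymm (Fin 0) ℚ (d + 1) = 0 := by
  unfold hsymm
  exact Finset.sum_of_isEmpty _

theorem esymm_succ (n d : ℕ) :
    esymm (Fin (n + 1)) ℚ (d + 1) =
      X 0 * rename Fin.succ (esymm (Fin n) ℚ d) + rename Fin.succ (esymm (Fin n) ℚ (d + 1)) := by
  have key : ∀ d, rename Fin.succ (esymm (Fin n) ℚ d) =
      ((Finset.univ : Finset (Fin n)).val.map fun i => (X i.succ : Poly (n + 1))).esymm d := by
    intro d
    rw [← aeval_esymm_eq_multiset_esymm (Fin n) ℚ]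
    exact DFunLike.congr_fun (algHom_ext (f := rename Fin.succ)
      (g := aeval fun i => (X i.succ : Poly (n + 1))) (by simp)) _
  rw [key, key, esymm_eq_multiset_esymm]
  have hu : (Finset.univ : Finset (Fin (n + 1))).val.map (X : Fin (n + 1) → Poly (n + 1)) =
      X 0 ::ₘ (Finset.univ : Finset (Fin n)).val.map fun i => (X i.succ : Poly (n + 1)) := by
    rw [Fin.univ_succ, Finset.cons_val, Multiset.map_cons, Finset.map_val, Multiset.map_map]
    rfl
  rw [hu]
  simp only [Multiset.esymm, Multiset.powersetCard_cons, Multiset.map_add, Multiset.sum_add,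
    Multiset.map_map, Function.comp_def, Multiset.prod_cons, Multiset.sum_map_mul_left]
  exact add_comm _ _

theorem esymm_eq_zero_of_lt {n d : ℕ} (h : n < d) : esymm (Fin n) ℚ d = 0 := by
  unfold esymm
  rw [Finset.powersetCard_eq_empty.2 (by simpa using h), Finset.sum_empty]

/-! ### Lexicographic leading monomials and the powers `x_i ^ (k + i)` -/

/-- The lexicographic degree of `f`, read off from `f` as a polynomial in its first variable. -/
theorem degree_lex_of_finSuccEquiv {n D : ℕ} {f : Poly (n + 1)}
    (hdeg : (finSuccEquiv ℚ n f).natDegree ≤ D) (hc : (finSuccEquiv ℚ n f).coeff D ≠ 0) :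
    f ≠ 0 ∧ MonomialOrder.lex.degree f =
      Finsupp.cons D (MonomialOrder.lex.degree ((finSuccEquiv ℚ n f).coeff D)) := by
  set g := (finSuccEquiv ℚ n f).coeff D with hg
  set b := MonomialOrder.lex.degree g with hb
  have hcoef : coeff (Finsupp.cons D b) f ≠ 0 := by
    rw [← finSuccEquiv_coeff_coeff]
    exact MonomialOrder.leadingCoeff_ne_zero_iff.2 hc
  have hf : f ≠ 0 := by
    rintro rfl
    simp at hcoef
  refine ⟨hf, MonomialOrder.lex.toSyn.injective (le_antisymm ?_ ?_)⟩
  · rw [MonomialOrder.degree_le_iff]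
    intro c hcs
    rw [mem_support_iff, ← Finsupp.cons_tail c, ← finSuccEquiv_coeff_coeff] at hcs
    have hle : c 0 ≤ D := by
      by_contra! h
      rw [Polynomial.coeff_eq_zero_of_natDegree_lt (hdeg.trans_lt h)] at hcs
      simp at hcs
    rcases hle.lt_or_eq with h | h
    · rw [MonomialOrder.lex_le_iff]
      refine le_of_lt (Finsupp.Lex.lt_iff.2 ⟨0, by simp, ?_⟩)
      simpa using h
    · rw [h] at hcs
      have h2 : MonomialOrder.lex.toSyn c.tail ≤ MonomialOrder.lex.toSyn b :=
        MonomialOrder.lex.le_degree (mem_support_iff.2 hcs)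
      rw [MonomialOrder.lex_le_iff] at h2 ⊢
      rcases h2.lt_or_eq with h3 | h3
      · obtain ⟨i, hi, hi'⟩ := Finsupp.Lex.lt_iff.1 h3
        refine le_of_lt (Finsupp.Lex.lt_iff.2 ⟨i.succ, ?_, ?_⟩)
        · intro j hj
          refine Fin.cases (by simpa using h) (fun j hj => ?_) j hj
          simpa [Finsupp.tail_apply] using hi j (Fin.succ_lt_succ_iff.1 hj)
        · simpa [Finsupp.tail_apply] using hi'
      · have h4 : c.tail = b := toLex.injective h3
        rw [← Finsupp.cons_tail c, h, h4]
  · exact MonomialOrder.lex.le_degree (mem_support_iff.2 hcoef)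

theorem degree_lex_rename_succ {n : ℕ} {g : Poly n} (hg : g ≠ 0) :
    rename Fin.succ g ≠ 0 ∧ MonomialOrder.lex.degree (rename Fin.succ g) =
      Finsupp.cons 0 (MonomialOrder.lex.degree g) := by
  have h := finSuccEquiv_rename_succ g
  have := degree_lex_of_finSuccEquiv (D := 0) (f := rename Fin.succ g) (by rw [h]; simp)
    (by rw [h]; simpa using hg)
  rwa [h, Polynomial.coeff_C_zero] at this

theorem finSuccEquiv_hsymm_succ (n d : ℕ) :
    finSuccEquiv ℚ n (hsymm (Fin (n + 1)) ℚ (d + 1)) =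
      Polynomial.X * finSuccEquiv ℚ n (hsymm (Fin (n + 1)) ℚ d) +
        Polynomial.C (hsymm (Fin n) ℚ (d + 1)) := by
  rw [hsymm_succ, map_add, map_mul, finSuccEquiv_X_zero, finSuccEquiv_rename_succ]

theorem finSuccEquiv_hsymm_monic (n d : ℕ) :
    (finSuccEquiv ℚ n (hsymm (Fin (n + 1)) ℚ d)).natDegree ≤ d ∧
      (finSuccEquiv ℚ n (hsymm (Fin (n + 1)) ℚ d)).coeff d = 1 := by
  induction d with
  | zero => simp
  | succ d ih =>
    rw [finSuccEquiv_hsymm_succ]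
    refine ⟨Polynomial.natDegree_add_le_of_degree_le ?_ (by simp), ?_⟩
    · refine Polynomial.natDegree_mul_le.trans ?_
      have := Polynomial.natDegree_X_le (R := Poly n)
      omega
    · simp [ih.2]

/-- The ideal `⟨h_{k+1}, …, h_{k+n}⟩` has an element with leading monomial `x_i ^ (k + i)`. -/
theorem exists_degree_eq_single (n k : ℕ) (i : Fin n) :
    ∃ f ∈ Ideal.span ((fun d => hsymm (Fin n) ℚ d) '' Set.Icc (k + 1) (k + n)),
      f ≠ 0 ∧ MonomialOrder.lex.degree f = Finsupp.single i (k + (i + 1)) := by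
  induction n generalizing k with
  | zero => exact i.elim0
  | succ n ih =>
    refine Fin.cases ?_ (fun j => ?_) i
    · obtain ⟨h1, h2⟩ := finSuccEquiv_hsymm_monic n (k + 1)
      have h3 := degree_lex_of_finSuccEquiv h1 (by rw [h2]; exact one_ne_zero)
      refine ⟨hsymm (Fin (n + 1)) ℚ (k + 1),
        Ideal.subset_span ⟨k + 1, ⟨le_rfl, by omega⟩, rfl⟩, h3.1, ?_⟩
      rw [h3.2, h2, MonomialOrder.degree_one, Finsupp.cons_zero_eq_single_zero]
      rfl
    -- Dropping `x_1` raises `k` by one: `h_{d+1} - x_1 h_d` is `h_{d+1}` in the remaining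
    -- variables, and costs the lowest degree `k + 1`.
    · obtain ⟨g, hg, hg0, hgd⟩ := ih (k + 1) j
      obtain ⟨h1, h2⟩ := degree_lex_rename_succ hg0
      refine ⟨rename Fin.succ g, ?_, h1, ?_⟩
      · have h3 := Ideal.mem_map_of_mem (rename Fin.succ : Poly n →ₐ[ℚ] Poly (n + 1)) hg
        rw [Ideal.map_span] at h3
        refine Ideal.span_le.2 ?_ h3
        rintro _ ⟨_, ⟨d, hd, rfl⟩, rfl⟩
        obtain ⟨d, rfl⟩ : ∃ e, d = e + 1 := ⟨d - 1, by have := hd.1; omega⟩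
        have h4 := hsymm_succ n d
        rw [SetLike.mem_coe]
        change rename Fin.succ (hsymm (Fin n) ℚ (d + 1)) ∈ _
        rw [← sub_eq_iff_eq_add'.2 h4]
        obtain ⟨hd1, hd2⟩ := hd
        exact Ideal.sub_mem _ (Ideal.subset_span ⟨d + 1, ⟨by omega, by omega⟩, rfl⟩)
          (Ideal.mul_mem_left _ _ (Ideal.subset_span ⟨d, ⟨by omega, by omega⟩, rfl⟩))
      · rw [h2, hgd, Finsupp.cons_zero_single_eq_single_succ]
        congr 1
        simp only [Fin.val_succ]
        omega

/-! ### Minors of elementary symmetric polynomials and skip monomials -/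

/-- The elementary symmetric polynomial `e_{d - l}`, which is zero for `d < l`. -/
noncomputable def shiftedEsymm (n d l : ℕ) : Poly n :=
  if l ≤ d then esymm (Fin n) ℚ (d - l) else 0

theorem shiftedEsymm_succ_succ (n d l : ℕ) :
    shiftedEsymm n (d + 1) (l + 1) = shiftedEsymm n d l := by
  simp [shiftedEsymm]

theorem shiftedEsymm_succ (n d l : ℕ) :
    shiftedEsymm (n + 1) d l =
      X 0 * rename Fin.succ (shiftedEsymm n d (l + 1)) + rename Fin.succ (shiftedEsymm n d l) := by
  unfold shiftedEsymm
  rcases lt_trichotomy l d with h | h | h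
  · obtain ⟨c, rfl⟩ := Nat.exists_eq_add_of_lt h
    rw [if_pos h.le, if_pos (by omega), if_pos h.le]
    rw [show l + c + 1 - l = c + 1 by omega, show l + c + 1 - (l + 1) = c by omega, esymm_succ]
  · subst h
    simp
  · rw [if_neg (by omega), if_neg (by omega), if_neg (by omega)]
    simp

/-- The `L × L` matrix with entries `e_{D_j - l}`, the rows being indexed by `l = L - 1, …, 0`. -/
noncomputable def esymmMatrix (n L : ℕ) (D : Fin L → ℕ) : Matrix (Fin L) (Fin L) (Poly n) :=
  Matrix.of fun i j => shiftedEsymm n (D j) (i.rev : ℕ)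

/-- The ideal of `L × L` minors whose columns are indexed by integers that are at least `m`. -/
noncomputable def minorIdeal (n m L : ℕ) : Ideal (Poly n) :=
  Ideal.span {p | ∃ D : Fin L → ℕ, (∀ j, m ≤ D j) ∧ (esymmMatrix n L D).det = p}

/-- Adding `x_1` times the preceding row to every row but the first turns the entries of those rows
into elementary symmetric polynomials in all variables. Expansion along the first row then leaves
minors of size `L`. -/
theorem rename_mem_minorIdeal {n m L : ℕ} {g : Poly n} (hg : g ∈ minorIdeal n m (L + 1)) :
    rename Fin.succ g ∈ minorIdeal (n + 1) m L := by
  have h3 := Ideal.mem_map_of_mem (rename Fin.succ : Poly n →ₐ[ℚ] Poly (n + 1)) hg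
  rw [minorIdeal, Ideal.map_span] at h3
  refine Ideal.span_le.2 ?_ h3
  rintro _ ⟨_, ⟨D, hD, rfl⟩, rfl⟩
  let B : Matrix (Fin (L + 1)) (Fin (L + 1)) (Poly (n + 1)) :=
    Matrix.of (Fin.cons (fun j => rename Fin.succ (shiftedEsymm n (D j) L))
      (fun i j => shiftedEsymm (n + 1) (D j) (i.rev : ℕ)))
  have hdet : rename Fin.succ (esymmMatrix n (L + 1) D).det = B.det := by
    rw [AlgHom.map_det]
    refine Matrix.det_eq_of_forall_row_eq_smul_add_pred (fun _ => -X 0) ?_ ?_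
    · intro j
      simp [B, esymmMatrix]
    · intro i j
      have hi : L - (i : ℕ) = L - (i + 1) + 1 := by omega
      simp [B, esymmMatrix, shiftedEsymm_succ, hi]
  rw [SetLike.mem_coe]
  rw [hdet, Matrix.det_succ_row_zero]
  refine Ideal.sum_mem _ fun j _ => Ideal.mul_mem_left _ _ (Ideal.subset_span ?_)
  exact ⟨fun i => D (j.succAbove i), fun i => hD _, rfl⟩

/-- With columns shifted by one, the matrix in `n + 1` variables is `x_1 M + M'` with `M`, `M'` free
of `x_1`, so the coefficient of `x_1 ^ L` in its determinant is `det M`. -/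
theorem exists_mem_minorIdeal_succ {n m L : ℕ} {g : Poly n} (hg : g ∈ minorIdeal n m L) :
    ∃ f ∈ minorIdeal (n + 1) (m + 1) L,
      (finSuccEquiv ℚ n f).natDegree ≤ L ∧ (finSuccEquiv ℚ n f).coeff L = g := by
  induction hg using Submodule.span_induction with
  | mem g hg =>
    obtain ⟨D, hD, rfl⟩ := hg
    refine ⟨_, Ideal.subset_span ⟨fun j => D j + 1, fun j => Nat.succ_le_succ (hD j), rfl⟩, ?_⟩
    have hdet : finSuccEquiv ℚ n (esymmMatrix (n + 1) L fun j => D j + 1).det =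
        ((Polynomial.X : Polynomial (Poly n)) • (esymmMatrix n L D).map Polynomial.C +
          (esymmMatrix n L fun j => D j + 1).map Polynomial.C).det := by
      rw [AlgEquiv.map_det]
      congr 1
      refine Matrix.ext fun i j => ?_
      simp [esymmMatrix, shiftedEsymm_succ n, shiftedEsymm_succ_succ, finSuccEquiv_X_zero,
        finSuccEquiv_rename_succ]
    rw [hdet]
    refine ⟨(Polynomial.natDegree_det_X_add_C_le _ _).trans (by simp), ?_⟩
    simpa using Polynomial.coeff_det_X_add_C_card (esymmMatrix n L D)
      (esymmMatrix n L fun j => D j + 1)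
  | zero => exact ⟨0, Ideal.zero_mem _, by simp, by simp⟩
  | add g g' _ _ h h' =>
    obtain ⟨f, hf, h1, h2⟩ := h
    obtain ⟨f', hf', h1', h2'⟩ := h'
    refine ⟨f + f', Ideal.add_mem _ hf hf', ?_, by simp [h2, h2']⟩
    rw [map_add]
    exact Polynomial.natDegree_add_le_of_degree_le h1 h1'
  | smul a g _ h =>
    obtain ⟨f, hf, h1, h2⟩ := h
    refine ⟨rename Fin.succ a * f, Ideal.mul_mem_left _ _ hf, ?_, ?_⟩
    · rw [map_mul, finSuccEquiv_rename_succ]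
      exact (Polynomial.natDegree_C_mul_le _ _).trans h1
    · rw [map_mul, finSuccEquiv_rename_succ, Polynomial.coeff_C_mul, h2, smul_eq_mul]

/-- The exponent vector of the skip monomial of `S` times the `L`-th power of `∏ i ∈ S, x_i`,
divided by `∏ i ∈ S, x_i`. -/
noncomputable def skipExponent {n : ℕ} (S : Finset (Fin n)) (L : ℕ) : Fin n →₀ ℕ :=
  Finsupp.equivFunOnFinite.symm fun i =>
    if i ∈ S then (i : ℕ) + L - (S.filter (· < i)).card else 0

/-- The elements of `S` other than the smallest index, lowered by one. -/
def lowered {n : ℕ} (S : Finset (Fin (n + 1))) : Finset (Fin n) :=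
  Finset.univ.filter fun i => i.succ ∈ S

theorem card_lowered_filter {n : ℕ} (S : Finset (Fin (n + 1))) (p : Fin (n + 1) → Prop)
    [DecidablePred p] (h0 : p 0) :
    (S.filter p).card =
      ((lowered S).filter fun i => p i.succ).card + if (0 : Fin (n + 1)) ∈ S then 1 else 0 := by
  have h : ∀ q : Fin (n + 1) → Prop, ∀ [DecidablePred q],
      (Finset.univ.filter q).card =
        (Finset.univ.filter fun i : Fin n => q i.succ).card + if q 0 then 1 else 0 := by
    intro q _
    rw [Fin.card_filter_univ_succ]
    split_ifs <;> simp
  have h1 : S.filter p = Finset.univ.filter fun i => i ∈ S ∧ p i := by ext; simp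
  have h2 : (lowered S).filter (fun i => p i.succ) =
      Finset.univ.filter fun i => i.succ ∈ S ∧ p i.succ := by ext; simp [lowered]
  rw [h1, h2, h]
  simp [h0]

/-- The size `L` is kept general because the induction raises it at each index outside `S`; only `L
= 1` is needed in the end. An index in `S` contributes `x_1 ^ L` and lowers `m`. -/
theorem exists_degree_eq_skipExponent (n m L : ℕ) (S : Finset (Fin n)) (hS : S.card = m) :
    ∃ f ∈ minorIdeal n m L, f ≠ 0 ∧ MonomialOrder.lex.degree f = skipExponent S L := by
  induction n generalizing m L with
  | zero =>
    obtain rfl : S = ∅ := Finset.eq_empty_of_isEmpty S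
    obtain rfl : m = 0 := by simpa using hS.symm
    -- Without variables only `e_0 = 1` survives, so these columns give the identity matrix.
    refine ⟨1, Ideal.subset_span ⟨fun j => (j.rev : ℕ), fun _ => Nat.zero_le _, ?_⟩, one_ne_zero,
      Subsingleton.elim _ _⟩
    rw [← Matrix.det_one (n := Fin L)]
    congr 1
    refine Matrix.ext fun i j => ?_
    simp only [esymmMatrix, shiftedEsymm, Matrix.of_apply]
    rcases lt_trichotomy i j with h | h | h
    · have h' : (j.rev : ℕ) < i.rev := Fin.rev_lt_rev.2 h
      rw [if_neg h'.not_ge, Matrix.one_apply_ne h.ne]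
    · subst h
      simp
    · have h' : (j.rev : ℕ) > i.rev := Fin.rev_lt_rev.2 h
      rw [if_pos h'.le, Matrix.one_apply_ne h.ne', esymm_eq_zero_of_lt (by omega)]
  | succ n ih =>
    have hcard : S.card = (lowered S).card + if (0 : Fin (n + 1)) ∈ S then 1 else 0 := by
      simpa using card_lowered_filter S (fun _ => True) trivial
    have hfil : ∀ i : Fin n, (S.filter (· < i.succ)).card =
        ((lowered S).filter (· < i)).card + if (0 : Fin (n + 1)) ∈ S then 1 else 0 := by
      intro i
      simpa using card_lowered_filter S (· < i.succ) (Fin.succ_pos i)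
    have hle : ∀ i : Fin n, ((lowered S).filter (· < i)).card ≤ i := fun i =>
      (Finset.card_le_card (Finset.filter_subset_filter _ (Finset.subset_univ _))).trans
        (by simp [Finset.filter_gt_eq_Iio])
    by_cases h0 : (0 : Fin (n + 1)) ∈ S
    · simp only [h0, if_true] at hcard hfil
      obtain ⟨g, hg, hg0, hgd⟩ := ih (m - 1) L (lowered S) (by omega)
      obtain ⟨f, hf, h1, h2⟩ := exists_mem_minorIdeal_succ hg
      rw [show m - 1 + 1 = m by omega] at hf
      obtain ⟨h3, h4⟩ := degree_lex_of_finSuccEquiv h1 (by rwa [h2])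
      refine ⟨f, hf, h3, ?_⟩
      rw [h4, h2, hgd]
      ext i
      refine Fin.cases (by simp [skipExponent, h0]) (fun j => ?_) i
      have := hle j
      simp only [skipExponent, Finsupp.cons_succ, Finsupp.equivFunOnFinite_symm_apply_apply, hfil,
        Fin.val_succ]
      simp only [lowered, Finset.mem_filter, Finset.mem_univ, true_and] at this ⊢
      congr 1
      omega
    · simp only [h0, if_false, add_zero] at hcard hfil
      obtain ⟨g, hg, hg0, hgd⟩ := ih m (L + 1) (lowered S) (by omega)
      obtain ⟨h3, h4⟩ := degree_lex_rename_succ hg0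
      refine ⟨_, rename_mem_minorIdeal hg, h3, ?_⟩
      rw [h4, hgd]
      ext i
      refine Fin.cases (by simp [skipExponent, h0]) (fun j => ?_) i
      simp only [skipExponent, Finsupp.cons_succ, Finsupp.equivFunOnFinite_symm_apply_apply, hfil,
        Fin.val_succ]
      simp only [lowered, Finset.mem_filter, Finset.mem_univ, true_and]
      congr 1
      omega

theorem skipMonomial_eq {n : ℕ} (S : Finset (Fin n)) :
    skipMonomial S = mon (skipExponent S 1) := by
  rw [mon, monomial_eq, C_1, one_mul, Finsupp.prod_fintype _ _ (by simp), skipMonomial,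
    ← Finset.prod_subset (Finset.subset_univ S)]
  · refine Finset.prod_congr rfl fun i hi => ?_
    simp [skipExponent, hi]
  · intro i _ hi
    simp [skipExponent, hi]

theorem standardMonomials_subset_goodMonomials (n k r : ℕ) :
    standardMonomials (idealI n k r) ⊆ goodMonomials n k r := by
  intro a ha
  rw [mem_standardMonomials_iff] at ha
  refine ⟨fun S hS hdvd => ?_, fun i hdvd => ?_⟩
  · obtain ⟨f, hf, hf0, hfd⟩ := exists_degree_eq_skipExponent n _ 1 S hS
    refine ha f (Ideal.span_le.2 ?_ hf) hf0 ?_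
    -- A minor of size 1 is a single `e_d` with `d ≥ n - r + 1`: a generator if `d ≤ n`, and zero
    -- otherwise.
    · rintro _ ⟨D, hD, rfl⟩
      rw [SetLike.mem_coe, Matrix.det_fin_one]
      simp only [esymmMatrix, shiftedEsymm, Matrix.of_apply]
      by_cases hn : D 0 ≤ n
      · exact Ideal.subset_span (Or.inr ⟨D 0, ⟨hD 0, hn⟩, by simp⟩)
      · simp [esymm_eq_zero_of_lt (not_le.1 hn)]
    · rw [hfd]
      rw [skipMonomial_eq, monomial_dvd_monomial] at hdvd
      simpa using hdvd
  · obtain ⟨f, hf, hf0, hfd⟩ := exists_degree_eq_single n k i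
    refine ha f (Ideal.span_mono Set.subset_union_left hf) hf0 ?_
    rw [hfd]
    rw [X_pow_eq_monomial, monomial_dvd_monomial] at hdvd
    simpa using hdvd

/-! ### Greedy choice of a staircase -/

theorem exists_greedy {n : ℕ} (a : Fin n → ℕ) :
    ∃ C : Finset (Fin n), ∀ i, i ∈ C ↔ a i ≤ (C.filter (· < i)).card := by
  have key : ∀ t ≤ n, ∃ C : Finset (Fin n), (∀ i ∈ C, (i : ℕ) < t) ∧
      ∀ i : Fin n, (i : ℕ) < t → (i ∈ C ↔ a i ≤ (C.filter (· < i)).card) := by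
    intro t
    induction t with
    | zero => exact fun _ => ⟨∅, by simp, by simp⟩
    | succ t ih =>
      intro ht
      obtain ⟨C, hC, h⟩ := ih (by omega)
      let x : Fin n := ⟨t, ht⟩
      have hx : x ∉ C := fun hx => lt_irrefl _ (hC x hx)
      by_cases hxa : a x ≤ (C.filter (· < x)).card
      · refine ⟨insert x C, ?_, fun i hi => ?_⟩
        · intro i hi
          rcases Finset.mem_insert.1 hi with rfl | hi
          · exact Nat.lt_succ_self t
          · exact (hC i hi).trans (Nat.lt_succ_self t)
        · have hxi : ¬ x < i := fun hlt => by
            have : t < i := hlt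
            omega
          rw [Finset.filter_insert, if_neg hxi, Finset.mem_insert]
          by_cases hix : i = x
          · subst hix
            simpa using hxa
          · have : (i : ℕ) ≠ t := fun he => hix (Fin.ext he)
            rw [← h i (by omega)]
            simp [hix]
      · refine ⟨C, fun i hi => (hC i hi).trans (Nat.lt_succ_self t), fun i hi => ?_⟩
        by_cases hix : i = x
        · subst hix
          simp [hx, hxa]
        · have : (i : ℕ) ≠ t := fun he => hix (Fin.ext he)
          exact h i (by omega)
  obtain ⟨C, -, h⟩ := key n le_rfl
  exact ⟨C, fun i => h i i.2⟩

/-- Skip exponents and staircases depend on a set only through counts of smaller elements, which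
truncation to an initial segment preserves. -/
theorem exists_initial_subset {α : Type*} [LinearOrder α] (A : Finset α) {m : ℕ}
    (hm : m ≤ A.card) :
    ∃ B ⊆ A, B.card = m ∧ ∀ b ∈ B, B.filter (· < b) = A.filter (· < b) := by
  induction A using Finset.induction_on_max with
  | empty => exact ⟨∅, by simp, by simpa [eq_comm] using hm, by simp⟩
  | insert x s hx ih =>
    rcases Nat.lt_or_ge s.card m with h | h
    · refine ⟨insert x s, subset_rfl, ?_, fun _ _ => rfl⟩
      have := Finset.card_insert_le x s
      omega
    · obtain ⟨B, hB, hBm, hlt⟩ := ih h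
      refine ⟨B, hB.trans (Finset.subset_insert _ _), hBm, fun b hb => ?_⟩
      rw [hlt b hb, Finset.filter_insert, if_neg (hx b (hB hb)).not_gt]

theorem goodMonomials_subset_subStaircaseMonomials (n k r : ℕ) (hr : r ≤ n) :
    goodMonomials n k r ⊆ subStaircaseMonomials n k r := by
  rintro a ⟨hS, hk⟩
  obtain ⟨C, hC⟩ := exists_greedy a
  have hcompl : Cᶜ.card ≤ n - r := by
    by_contra! h
    obtain ⟨S, hSC, hSm, hlt⟩ := exists_initial_subset Cᶜ (Nat.succ_le_of_lt h)
    refine hS S hSm ?_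
    rw [skipMonomial_eq, monomial_dvd_monomial]
    refine ⟨Or.inr fun i => ?_, one_dvd _⟩
    by_cases hi : i ∈ S
    -- Rejection of `i` means that `a i` exceeds the number of accepted indices below `i`, which is
    -- `i` minus the number of rejected ones: this is the skip exponent.
    · have h1 := (hC i).not.1 (Finset.mem_compl.1 (hSC hi))
      have h2 : (C.filter (· < i)).card + (Cᶜ.filter (· < i)).card = i := by
        rw [← Finset.card_union_of_disjoint (Finset.disjoint_filter_filter disjoint_compl_right),
          ← Finset.filter_union, Finset.union_compl, Finset.filter_gt_eq_Iio, Fin.card_Iio]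
      simp only [skipExponent, Finsupp.equivFunOnFinite_symm_apply_apply, if_pos hi, hlt i hi]
      omega
    · simp [skipExponent, hi]
  have hcard : r ≤ C.card := by
    have := C.card_add_card_compl
    rw [Fintype.card_fin] at this
    omega
  obtain ⟨B, hBC, hBm, hlt⟩ := exists_initial_subset C hcard
  refine ⟨Bᶜ, by rw [Finset.card_compl, hBm, Fintype.card_fin], fun i => ?_⟩
  rw [staircase, compl_compl]
  split_ifs with h
  · by_contra! hlt
    refine hk i ?_
    rw [X_pow_eq_monomial, monomial_dvd_monomial]
    refine ⟨Or.inr (Finsupp.single_le_iff.2 ?_), one_dvd _⟩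
    omega
  · have hi : i ∈ B := by simpa using h
    rw [hlt i hi]
    exact (hC i).1 (hBC hi)

/-! ### Staircases under removal of the last coordinate -/

/-- The exponent vectors below a staircase, with `C` the complement of the set `T`, as a set of
natural numbers. -/
def BelowStaircase (n k r : ℕ) (a : Fin n → ℕ) : Prop :=
  ∃ C ⊆ Finset.range n, C.card = r ∧
    ∀ i : Fin n, a i ≤ if (i : ℕ) ∈ C then (C.filter (· < (i : ℕ))).card else i + k

theorem belowStaircase_of_mem {n k r : ℕ} (hr : r ≤ n) {a : Fin n →₀ ℕ}
    (ha : a ∈ subStaircaseMonomials n k r) : BelowStaircase n k r a := by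
  obtain ⟨T, hT, ha⟩ := ha
  refine ⟨Tᶜ.map Fin.valEmbedding, ?_, ?_, fun i => ?_⟩
  · intro x hx
    obtain ⟨i, -, rfl⟩ := Finset.mem_map.1 hx
    exact Finset.mem_range.2 i.2
  · rw [Finset.card_map, Finset.card_compl, hT, Fintype.card_fin]
    omega
  · refine (ha i).trans ?_
    rw [staircase, Finset.filter_map, Finset.card_map]
    have : (i : ℕ) ∈ Tᶜ.map Fin.valEmbedding ↔ i ∉ T := by simp [Fin.val_inj]
    by_cases hi : i ∈ T
    · rw [if_pos hi, if_neg (by rw [this]; exact not_not.2 hi)]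
      omega
    · rw [if_neg hi, if_pos (this.2 hi)]
      exact le_of_eq rfl

/-- Removing the largest element `x` of `C` weakens the bound at `x` to `x + k` and changes no other
bound. -/
theorem BelowStaircase.of_succ {n k r : ℕ} {a : Fin n → ℕ} (h : BelowStaircase n k (r + 1) a) :
    BelowStaircase n k r a := by
  obtain ⟨C, hC, hr, ha⟩ := h
  have hne : C.Nonempty := Finset.card_pos.1 (by omega)
  set x := C.max' hne with hx
  have hxC : x ∈ C := C.max'_mem hne
  refine ⟨C.erase x, (Finset.erase_subset _ _).trans hC, by rw [Finset.card_erase_of_mem hxC]; omega,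
    fun i => (ha i).trans ?_⟩
  by_cases hi : (i : ℕ) ∈ C
  · rw [if_pos hi]
    by_cases hix : (i : ℕ) = x
    · rw [if_neg (by simp [hix])]
      have h1 : (C.filter (· < (i : ℕ))).card ≤ (Finset.range i).card :=
        Finset.card_le_card fun j hj => Finset.mem_range.2 (Finset.mem_filter.1 hj).2
      rw [Finset.card_range] at h1
      omega
    · rw [if_pos (Finset.mem_erase.2 ⟨hix, hi⟩), Finset.filter_erase, Finset.erase_eq_of_notMem]
      intro h
      have := (Finset.mem_filter.1 h).2
      have := C.le_max' _ hi
      omega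
  · rw [if_neg hi, if_neg fun h => hi (Finset.mem_of_mem_erase h)]

theorem BelowStaircase.last_le {n k r : ℕ} {a : Fin (n + 1) → ℕ}
    (h : BelowStaircase (n + 1) k r a) : a (Fin.last n) ≤ n + k := by
  obtain ⟨C, hC, hr, ha⟩ := h
  refine (ha _).trans ?_
  split_ifs with h
  · have h1 : (C.filter (· < n)).card ≤ (Finset.range n).card :=
      Finset.card_le_card fun j hj => Finset.mem_range.2 (Finset.mem_filter.1 hj).2
    rw [Finset.card_range] at h1
    simp only [Fin.val_last]
    omega
  · simp

theorem BelowStaircase.init_of_notMem {n k r : ℕ} {a : Fin (n + 1) → ℕ} {C : Finset ℕ}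
    (hC : C ⊆ Finset.range (n + 1)) (hr : C.card = r)
    (ha : ∀ i : Fin (n + 1), a i ≤
      if (i : ℕ) ∈ C then (C.filter (· < (i : ℕ))).card else i + k) (hn : n ∉ C) :
    BelowStaircase n k r fun i => a i.castSucc := by
  refine ⟨C, fun i hi => ?_, hr, fun i => ha i.castSucc⟩
  have := Finset.mem_range.1 (hC hi)
  have : i ≠ n := fun h => hn (h ▸ hi)
  exact Finset.mem_range.2 (by omega)

/-- If the last index were in `C`, its exponent would be at most `r - 1`. -/
theorem BelowStaircase.init_of_le {n k r : ℕ} {a : Fin (n + 1) → ℕ}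
    (h : BelowStaircase (n + 1) k r a) (hle : r ≤ a (Fin.last n)) :
    BelowStaircase n k r fun i => a i.castSucc := by
  obtain ⟨C, hC, hr, ha⟩ := h
  refine init_of_notMem hC hr ha fun hn => ?_
  have h1 := ha (Fin.last n)
  rw [Fin.val_last, if_pos hn] at h1
  have h2 : C.filter (· < n) ⊂ C :=
    Finset.filter_ssubset.2 ⟨n, hn, lt_irrefl n⟩
  have := Finset.card_lt_card h2
  omega

theorem BelowStaircase.init_of_succ {n k r : ℕ} {a : Fin (n + 1) → ℕ}
    (h : BelowStaircase (n + 1) k (r + 1) a) : BelowStaircase n k r fun i => a i.castSucc := by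
  obtain ⟨C, hC, hr, ha⟩ := h
  by_cases hn : n ∈ C
  · refine ⟨C.erase n, fun i hi => ?_, by rw [Finset.card_erase_of_mem hn]; omega, fun i => ?_⟩
    · have h1 := Finset.mem_range.1 (hC (Finset.mem_of_mem_erase hi))
      have h2 := Finset.ne_of_mem_erase hi
      exact Finset.mem_range.2 (by omega)
    · refine (ha i.castSucc).trans (le_of_eq ?_)
      have h1 : (i : ℕ) ≠ n := i.2.ne
      have h2 : n ∉ C.filter (· < (i : ℕ)) := fun h => by
        have := (Finset.mem_filter.1 h).2
        omega
      simp only [Fin.val_castSucc, Finset.mem_erase, ne_eq, h1, not_false_eq_true, true_and,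
        Finset.filter_erase, Finset.erase_eq_of_notMem h2]
  · exact (init_of_notMem hC hr ha hn).of_succ

/-! ### Polynomials supported below staircases do not vanish on the point locus -/

/-- The exponents of all variables but the last. -/
noncomputable def initExponent {n : ℕ} (m : Fin (n + 1) →₀ ℕ) : Fin n →₀ ℕ :=
  Finsupp.equivFunOnFinite.symm fun i => m i.castSucc

/-- Substitution of a rational number for the last variable. -/
noncomputable def evalLast {n : ℕ} (f : Poly (n + 1)) (c : ℚ) : Poly n :=
  ∑ m ∈ f.support, monomial (initExponent m) (coeff m f * c ^ m (Fin.last n))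

/-- The coefficient of a monomial in all variables but the last, a polynomial in the last one. -/
noncomputable def coeffInit {n : ℕ} (f : Poly (n + 1)) (b : Fin n →₀ ℕ) : Polynomial ℚ :=
  ∑ m ∈ f.support with initExponent m = b, Polynomial.monomial (m (Fin.last n)) (coeff m f)

theorem eval_evalLast {n : ℕ} (f : Poly (n + 1)) (c : ℚ) (y : Fin n → ℚ) :
    eval y (evalLast f c) = eval (Fin.snoc y c : Fin (n + 1) → ℚ) f := by
  rw [evalLast, map_sum, eval_eq']
  refine Finset.sum_congr rfl fun m _ => ?_
  rw [eval_monomial, Finsupp.prod_fintype _ _ (by simp), Fin.prod_univ_castSucc]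
  simp only [initExponent, Finsupp.equivFunOnFinite_symm_apply_apply, Fin.snoc_castSucc,
    Fin.snoc_last]
  ring

theorem coeff_evalLast {n : ℕ} (f : Poly (n + 1)) (c : ℚ) (b : Fin n →₀ ℕ) :
    coeff b (evalLast f c) = (coeffInit f b).eval c := by
  rw [evalLast, coeffInit, coeff_sum, Polynomial.eval_finsetSum, Finset.sum_filter]
  refine Finset.sum_congr rfl fun m _ => ?_
  rw [coeff_monomial]
  split_ifs <;> simp

theorem exists_of_coeffInit_ne_zero {n : ℕ} {f : Poly (n + 1)} {b : Fin n →₀ ℕ}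
    (h : coeffInit f b ≠ 0) : ∃ m ∈ f.support, initExponent m = b := by
  obtain ⟨m, hm, -⟩ := Finset.exists_ne_zero_of_sum_ne_zero h
  exact ⟨m, Finset.mem_filter.1 hm⟩

theorem degree_coeffInit_lt {n N : ℕ} {f : Poly (n + 1)} {b : Fin n →₀ ℕ}
    (h : ∀ m ∈ f.support, initExponent m = b → m (Fin.last n) < N) :
    (coeffInit f b).degree < N := by
  rw [← Polynomial.mem_degreeLT]
  refine Submodule.sum_mem _ fun m hm => Polynomial.mem_degreeLT.2 ?_
  obtain ⟨hm, hb⟩ := Finset.mem_filter.1 hm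
  exact (Polynomial.degree_monomial_le _ _).trans_lt (by exact_mod_cast h m hm hb)

theorem eq_zero_of_coeffInit {n : ℕ} {f : Poly (n + 1)} (h : ∀ b, coeffInit f b = 0) : f = 0 := by
  by_contra hf
  obtain ⟨m, hm⟩ := Finset.nonempty_of_ne_empty (support_eq_empty.not.2 hf)
  refine mem_support_iff.1 hm ?_
  have h1 := congrArg (Polynomial.coeff · (m (Fin.last n))) (h (initExponent m))
  simp only [coeffInit, Polynomial.finsetSum_coeff, Polynomial.coeff_monomial,
    Polynomial.coeff_zero] at h1
  rw [Finset.sum_eq_single m] at h1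
  · simpa using h1
  · intro b hb hbm
    refine if_neg fun hl => hbm (Finsupp.ext fun i => ?_)
    refine Fin.lastCases hl (fun j => ?_) i
    exact DFunLike.congr_fun (Finset.mem_filter.1 hb).2 j
  · intro hm'
    exact (hm' (by simpa using hm)).elim

/-- The points with distinct coordinates in `A` such that every element of `L` is a coordinate. -/
def pointLocus (n : ℕ) (A L : Finset ℚ) : Set (Fin n → ℚ) :=
  {y | Function.Injective y ∧ (∀ i, y i ∈ A) ∧ ∀ b ∈ L, ∃ i, y i = b}

theorem snoc_mem_pointLocus {n : ℕ} {A L L' : Finset ℚ} {c : ℚ} (hc : c ∈ A)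
    (hL : L ⊆ insert c L') {y : Fin n → ℚ} (hy : y ∈ pointLocus n (A.erase c) L') :
    (Fin.snoc y c : Fin (n + 1) → ℚ) ∈ pointLocus (n + 1) A L := by
  obtain ⟨h1, h2, h3⟩ := hy
  refine ⟨?_, ?_, ?_⟩
  · rw [Fin.snoc_injective_iff]
    refine ⟨h1, ?_⟩
    rintro ⟨i, hi⟩
    exact Finset.ne_of_mem_erase (h2 i) hi
  · intro i
    refine Fin.lastCases (by simpa using hc) (fun j => ?_) i
    simpa using Finset.mem_of_mem_erase (h2 j)
  · intro b hb
    rcases Finset.mem_insert.1 (hL hb) with rfl | hb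
    · exact ⟨Fin.last n, by simp⟩
    · obtain ⟨i, hi⟩ := h3 b hb
      exact ⟨i.castSucc, by simpa using hi⟩

/-- Induction on `n`, specializing the last variable to each `c ∈ A`. The values in `L` come first:
the roots they provide shrink the support enough for the induction hypothesis to apply at the values
outside `L`. -/
theorem eq_zero_of_eval_pointLocus {n k r : ℕ} {A L : Finset ℚ} (hLA : L ⊆ A)
    (hA : A.card = n + k) (hL : L.card = r) {f : Poly n}
    (hf : ∀ m ∈ f.support, BelowStaircase n k r m)
    (hy : ∀ y ∈ pointLocus n A L, eval y f = 0) : f = 0 := by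
  induction n generalizing r A L with
  | zero =>
    by_contra hf0
    obtain ⟨m, hm⟩ := Finset.nonempty_of_ne_empty (support_eq_empty.not.2 hf0)
    obtain ⟨C, hC, hr, -⟩ := hf m hm
    rw [Finset.range_zero, Finset.subset_empty] at hC
    rw [hC, Finset.card_empty, ← hL] at hr
    obtain rfl := Finset.card_eq_zero.1 hr.symm
    have := hy Fin.elim0 ⟨fun i => i.elim0, fun i => i.elim0, by simp⟩
    rw [eq_C_of_isEmpty f, eval_C] at this
    rw [eq_C_of_isEmpty f, this, C_0] at hf0
    exact hf0 rfl
  | succ n ih =>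
    have hroot : ∀ c ∈ L, ∀ b, (coeffInit f b).eval c = 0 := by
      intro c hc b
      obtain ⟨s, rfl⟩ : ∃ s, r = s + 1 :=
        ⟨r - 1, by have := Finset.card_pos.2 ⟨c, hc⟩; omega⟩
      have h0 : evalLast f c = 0 := by
        refine ih (r := s) (A := A.erase c) (L := L.erase c) (Finset.erase_subset_erase _ hLA)
          (by rw [Finset.card_erase_of_mem (hLA hc)]; omega)
          (by rw [Finset.card_erase_of_mem hc]; omega) ?_ ?_
        · intro m hm
          rw [mem_support_iff, coeff_evalLast] at hm
          obtain ⟨m', hm', rfl⟩ := exists_of_coeffInit_ne_zero (f := f) (b := m)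
            (fun h => hm (by rw [h, Polynomial.eval_zero]))
          exact (hf m' hm').init_of_succ
        · intro y hy'
          rw [eval_evalLast]
          exact hy _ (snoc_mem_pointLocus (hLA hc) (by rw [Finset.insert_erase hc]) hy')
      rw [← coeff_evalLast, h0, coeff_zero]
    -- For such `b` the last exponent is always below `r`, while all `r` elements of `L` are roots.
    have hsupp : ∀ b : Fin n →₀ ℕ, ¬ BelowStaircase n k r b → coeffInit f b = 0 := by
      intro b hb
      refine Polynomial.eq_zero_of_degree_lt_of_eval_finset_eq_zero L
        (degree_coeffInit_lt fun m hm hmb => ?_) fun c hc => hroot c hc b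
      by_contra! hle
      rw [hL] at hle
      subst hmb
      exact hb ((hf m hm).init_of_le hle)
    refine eq_zero_of_coeffInit fun b => ?_
    -- The last exponent is at most `n + k`, and `A` has `n + 1 + k` elements.
    refine Polynomial.eq_zero_of_degree_lt_of_eval_finset_eq_zero A
      (degree_coeffInit_lt fun m hm _ => ?_) fun c hc => ?_
    · have := (hf m hm).last_le
      omega
    · by_cases hcL : c ∈ L
      · exact hroot c hcL b
      · have h0 : evalLast f c = 0 := by
          refine ih (r := r) (A := A.erase c) (L := L)
            (fun x hx => Finset.mem_erase.2 ⟨fun h => hcL (h ▸ hx), hLA hx⟩)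
            (by rw [Finset.card_erase_of_mem hc]; omega) hL ?_ ?_
          · intro m hm
            rw [mem_support_iff, coeff_evalLast] at hm
            by_contra hm'
            exact hm (by rw [hsupp m hm', Polynomial.eval_zero])
          · intro y hy'
            rw [eval_evalLast]
            exact hy _ (snoc_mem_pointLocus hc (Finset.subset_insert _ _) hy')
        rw [← coeff_evalLast, h0, coeff_zero]

/-! ### Homogeneity and generating functions -/

theorem hsymm_isHomogeneous (n d : ℕ) : (hsymm (Fin n) ℚ d).IsHomogeneous d := by
  induction n generalizing d with
  | zero =>
    cases d with
    | zero => rw [hsymm_zero]; exact isHomogeneous_one _ _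
    | succ d => rw [hsymm_fin_zero_succ]; exact isHomogeneous_zero _ _ _
  | succ n ihn =>
    induction d with
    | zero => rw [hsymm_zero]; exact isHomogeneous_one _ _
    | succ d ihd =>
      rw [hsymm_succ]
      refine IsHomogeneous.add ?_ (ihn _).rename_isHomogeneous
      rw [add_comm d 1]
      exact (isHomogeneous_X _ _).mul ihd

theorem esymm_isHomogeneous (n d : ℕ) : (esymm (Fin n) ℚ d).IsHomogeneous d := by
  induction n generalizing d with
  | zero =>
    cases d with
    | zero => rw [esymm_zero]; exact isHomogeneous_one _ _
    | succ d => rw [esymm_eq_zero_of_lt (Nat.succ_pos d)]; exact isHomogeneous_zero _ _ _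
  | succ n ihn =>
    cases d with
    | zero => rw [esymm_zero]; exact isHomogeneous_one _ _
    | succ d =>
      rw [esymm_succ]
      refine IsHomogeneous.add ?_ (ihn _).rename_isHomogeneous
      rw [add_comm d 1]
      exact (isHomogeneous_X _ _).mul (ihn d).rename_isHomogeneous

theorem hsymm_series_mul (n : ℕ) (y : Fin n → ℚ) :
    PowerSeries.mk (fun d => eval y (hsymm (Fin n) ℚ d)) *
      ∏ i, (1 + PowerSeries.C (-y i) * PowerSeries.X) = 1 := by
  induction n with
  | zero =>
    ext d
    cases d with
    | zero => simp
    | succ d => simp [hsymm_fin_zero_succ, PowerSeries.coeff_one]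
  | succ n ih =>
    rw [Fin.prod_univ_succ, ← mul_assoc]
    refine Eq.trans ?_ (ih fun i => y i.succ)
    congr 1
    ext d
    cases d with
    | zero => simp [mul_add]
    | succ d =>
      rw [mul_add, mul_one, ← mul_assoc, map_add, PowerSeries.coeff_succ_mul_X, mul_comm,
        PowerSeries.coeff_C_mul, PowerSeries.coeff_mk, PowerSeries.coeff_mk, PowerSeries.coeff_mk,
        hsymm_succ, map_add, map_mul, eval_X, eval_rename]
      simp only [Function.comp_def]
      ring

theorem esymm_series_eq (n : ℕ) (y : Fin n → ℚ) :
    PowerSeries.mk (fun d => eval y (esymm (Fin n) ℚ d)) =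
      ∏ i, (1 + PowerSeries.C (y i) * PowerSeries.X) := by
  induction n with
  | zero =>
    ext d
    cases d with
    | zero => simp
    | succ d => simp [esymm_eq_zero_of_lt (Nat.succ_pos d), PowerSeries.coeff_one]
  | succ n ih =>
    rw [Fin.prod_univ_succ, ← ih fun i => y i.succ, add_mul, one_mul, mul_assoc]
    ext d
    cases d with
    | zero => simp
    | succ d =>
      rw [map_add, PowerSeries.coeff_C_mul, PowerSeries.coeff_succ_X_mul, PowerSeries.coeff_mk,
        PowerSeries.coeff_mk, PowerSeries.coeff_mk, esymm_succ, map_add, map_mul, eval_X,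
        eval_rename, eval_rename]
      simp only [Function.comp_def]
      ring

theorem coeff_prod_one_add_C_mul_X (s : Finset ℚ) (c : ℚ → ℚ) {d : ℕ} (hd : s.card < d) :
    PowerSeries.coeff d (∏ a ∈ s, (1 + PowerSeries.C (c a) * PowerSeries.X)) = 0 := by
  induction s using Finset.induction_on generalizing d with
  | empty =>
    rw [Finset.card_empty] at hd
    simp [PowerSeries.coeff_one, hd.ne']
  | insert a s ha ih =>
    rw [Finset.card_insert_of_notMem ha] at hd
    obtain ⟨d, rfl⟩ : ∃ e, d = e + 1 := ⟨d - 1, by omega⟩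
    rw [Finset.prod_insert ha, add_mul, one_mul, mul_assoc, map_add, PowerSeries.coeff_C_mul,
      PowerSeries.coeff_succ_X_mul, ih (by omega), ih (by omega), mul_zero, add_zero]

/-- The coordinates of `y` cancel `n` of the `n + k` factors, leaving a polynomial of degree at most
`k`. -/
theorem coeff_hsymm_series_mul {n k : ℕ} {A L : Finset ℚ} (hA : A.card = n + k) {y : Fin n → ℚ}
    (hy : y ∈ pointLocus n A L) {d : ℕ} (hd : k < d) :
    PowerSeries.coeff d (PowerSeries.mk (fun d => eval y (hsymm (Fin n) ℚ d)) *
      ∏ a ∈ A, (1 + PowerSeries.C (-a) * PowerSeries.X)) = 0 := by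
  obtain ⟨h1, h2, -⟩ := hy
  have hsub : Finset.univ.image y ⊆ A := Finset.image_subset_iff.2 fun i _ => h2 i
  rw [← Finset.prod_sdiff hsub, Finset.prod_image h1.injOn, mul_left_comm, hsymm_series_mul,
    mul_one]
  refine coeff_prod_one_add_C_mul_X _ (fun a => -a) ?_
  rw [Finset.card_sdiff_of_subset hsub, Finset.card_image_of_injective _ h1, Finset.card_univ,
    Fintype.card_fin]
  omega

/-- All of `L` occurs among the coordinates of `y`, so the quotient is a product of `n - |L|` linear
factors. -/
theorem coeff_esymm_series_mul {n : ℕ} {A L : Finset ℚ} {y : Fin n → ℚ}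
    (hy : y ∈ pointLocus n A L) {d : ℕ} (hd : n - L.card < d) :
    PowerSeries.coeff d (PowerSeries.mk (fun d => eval y (esymm (Fin n) ℚ d)) *
      (∏ a ∈ L, (1 + PowerSeries.C a * PowerSeries.X))⁻¹) = 0 := by
  obtain ⟨h1, -, h3⟩ := hy
  have hsub : L ⊆ Finset.univ.image y := fun b hb => by simpa using h3 b hb
  have hprod : ∏ i, (1 + PowerSeries.C (y i) * PowerSeries.X) =
      ∏ a ∈ Finset.univ.image y, (1 + PowerSeries.C a * PowerSeries.X) := by
    rw [Finset.prod_image h1.injOn]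
  rw [esymm_series_eq, hprod, ← Finset.prod_sdiff hsub, mul_assoc, PowerSeries.mul_inv_cancel,
    mul_one]
  · refine coeff_prod_one_add_C_mul_X _ id ?_
    rwa [Finset.card_sdiff_of_subset hsub, Finset.card_image_of_injective _ h1, Finset.card_univ,
      Fintype.card_fin]
  · simp [map_prod]

/-! ### Transfer from the vanishing ideal to the homogeneous ideal -/

/-- All monomials of `f` have degree less than `d`. -/
def DegreeLT {n : ℕ} (d : ℕ) (f : Poly n) : Prop :=
  ∀ m : Fin n →₀ ℕ, d ≤ m.degree → coeff m f = 0

/-- Every homogeneous component of `f` is, up to terms of lower degree, in the ideal `J`. -/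
def ComponentsLift {n : ℕ} (J : Ideal (Poly n)) (f : Poly n) : Prop :=
  ∀ d, ∃ p ∈ J, DegreeLT d (p - homogeneousComponent d f)

theorem componentsLift_of_isHomogeneous {n d : ℕ} {J : Ideal (Poly n)} {f p : Poly n}
    (hf : f.IsHomogeneous d) (hp : p ∈ J) (h : DegreeLT d (p - f)) : ComponentsLift J f := by
  intro e
  rw [homogeneousComponent_of_mem hf]
  split_ifs with he
  · exact ⟨p, hp, he ▸ h⟩
  · exact ⟨0, J.zero_mem, fun m _ => by simp⟩

theorem ComponentsLift.add {n : ℕ} {J : Ideal (Poly n)} {f g : Poly n} (hf : ComponentsLift J f)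
    (hg : ComponentsLift J g) : ComponentsLift J (f + g) := by
  intro d
  obtain ⟨p, hp, h⟩ := hf d
  obtain ⟨q, hq, h'⟩ := hg d
  refine ⟨p + q, J.add_mem hp hq, fun m hm => ?_⟩
  rw [map_add, add_sub_add_comm, coeff_add, h m hm, h' m hm, add_zero]

theorem ComponentsLift.C_mul {n : ℕ} {J : Ideal (Poly n)} {f : Poly n} (hf : ComponentsLift J f)
    (c : ℚ) : ComponentsLift J (C c * f) := by
  intro d
  obtain ⟨p, hp, h⟩ := hf d
  refine ⟨C c * p, J.mul_mem_left _ hp, fun m hm => ?_⟩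
  rw [homogeneousComponent_C_mul, ← mul_sub, coeff_C_mul, h m hm, mul_zero]

theorem ComponentsLift.X_mul {n : ℕ} {J : Ideal (Poly n)} {f : Poly n} (hf : ComponentsLift J f)
    (i : Fin n) : ComponentsLift J (X i * f) := by
  have hdeg : ∀ m : Fin n →₀ ℕ, i ∈ m.support →
      (m - Finsupp.single i 1).degree + 1 = m.degree := by
    intro m hm
    have h1 : Finsupp.single i 1 ≤ m :=
      Finsupp.single_le_iff.2 (Nat.one_le_iff_ne_zero.2 (Finsupp.mem_support_iff.1 hm))
    conv_rhs => rw [← tsub_add_cancel_of_le h1]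
    rw [map_add, Finsupp.degree_single]
  intro d
  cases d with
  | zero =>
    refine ⟨0, J.zero_mem, fun m _ => ?_⟩
    simp [coeff_X_mul']
  | succ d =>
    obtain ⟨p, hp, h⟩ := hf d
    refine ⟨X i * p, J.mul_mem_left _ hp, fun m hm => ?_⟩
    have hc : homogeneousComponent (d + 1) (X i * f) = X i * homogeneousComponent d f := by
      ext m
      rw [coeff_homogeneousComponent, coeff_X_mul', coeff_X_mul', coeff_homogeneousComponent]
      by_cases hi : i ∈ m.support
      · rw [if_pos hi, if_pos hi, ← hdeg m hi]
        simp
      · simp [hi]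
    rw [hc, ← mul_sub, coeff_X_mul']
    split_ifs with hi
    · exact h _ (by have := hdeg m hi; omega)
    · rfl

theorem componentsLift_of_mem_span {n : ℕ} {J : Ideal (Poly n)} {G : Set (Poly n)}
    (hG : ∀ g ∈ G, ComponentsLift J g) {f : Poly n} (hf : f ∈ Ideal.span G) :
    ComponentsLift J f := by
  induction hf using Submodule.span_induction with
  | mem g hg => exact hG g hg
  | zero => exact fun d => ⟨0, J.zero_mem, fun m _ => by simp⟩
  | add f g _ _ hf hg => exact hf.add hg
  | smul a f _ hf =>
    rw [smul_eq_mul]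
    induction a using MvPolynomial.induction_on with
    | C c => exact hf.C_mul c
    | add p q hp hq => rw [add_mul]; exact hp.add hq
    | mul_X p i hp => rw [mul_comm p, mul_assoc]; exact hp.X_mul i

/-- The vanishing coefficient is `∑ c_j g_{d-j}` evaluated at `y`; since `c_0 = 1`, its top-degree
part is `g_d`. -/
theorem componentsLift_of_coeff_eq_zero {n d : ℕ} {Y : Set (Fin n → ℚ)} {g : ℕ → Poly n}
    (hg : ∀ e, (g e).IsHomogeneous e) {c : PowerSeries ℚ} (hc : PowerSeries.constantCoeff c = 1)
    (h : ∀ y ∈ Y, PowerSeries.coeff d (PowerSeries.mk (fun e => eval y (g e)) * c) = 0) :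
    ComponentsLift (vanishingIdeal ℚ Y) (g d) := by
  refine componentsLift_of_isHomogeneous (hg d)
    (p := ∑ q ∈ Finset.HasAntidiagonal.antidiagonal d, C (PowerSeries.coeff q.2 c) * g q.1) ?_ fun m hm => ?_
  · rw [mem_vanishingIdeal_iff]
    intro y hy
    rw [← h y hy, PowerSeries.coeff_mul, map_sum]
    refine Finset.sum_congr rfl fun q _ => ?_
    simp [mul_comm]
  · rw [coeff_sub, coeff_sum, Finset.sum_eq_single (d, 0)]
    · simp [hc]
    · rintro ⟨i, j⟩ hij hne
      have h1 := Finset.HasAntidiagonal.mem_antidiagonal.1 hij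
      simp only at h1
      have h2 : j ≠ 0 := by
        rintro rfl
        exact hne (by rw [← h1, add_zero])
      rw [coeff_C_mul, (hg i).coeff_eq_zero (by omega), mul_zero]
    · intro h
      simp at h

theorem componentsLift_of_mem_idealI {n k r : ℕ} {A L : Finset ℚ}
    (hA : A.card = n + k) (hL : L.card = r) {f : Poly n} (hf : f ∈ idealI n k r) :
    ComponentsLift (vanishingIdeal ℚ (pointLocus n A L)) f := by
  refine componentsLift_of_mem_span ?_ hf
  rintro _ (⟨d, hd, rfl⟩ | ⟨d, hd, rfl⟩)
  · exact componentsLift_of_coeff_eq_zero (hsymm_isHomogeneous n) (by simp [map_prod])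
      fun y hy => coeff_hsymm_series_mul hA hy hd.1
  · exact componentsLift_of_coeff_eq_zero (esymm_isHomogeneous n) (by simp [map_prod])
      fun y hy => coeff_esymm_series_mul hy (by rw [hL]; exact hd.1)

theorem exists_sub_mem_of_standardMonomials_subset {n : ℕ} {I : Ideal (Poly n)}
    {S : Set (Fin n →₀ ℕ)} (hS : standardMonomials I ⊆ S) (p : Poly n) :
    ∃ v : Poly n, (∀ m ∈ v.support, m ∈ S) ∧ p - v ∈ I := by
  have hp : Ideal.Quotient.mk I p ∈ Submodule.span ℚ (Set.range
      (fun a : standardMonomials I => Ideal.Quotient.mk I (mon a.1))) := by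
    rw [(standardMonomials_basis I).2]
    trivial
  obtain ⟨l, hl⟩ := Finsupp.mem_span_range_iff_exists_finsupp.1 hp
  refine ⟨l.sum fun a c => c • mon a.1, fun m hm => ?_, ?_⟩
  · rw [mem_support_iff, Finsupp.sum, coeff_sum] at hm
    obtain ⟨a, -, ha⟩ := Finset.exists_ne_zero_of_sum_ne_zero hm
    rw [coeff_smul, coeff_monomial] at ha
    split_ifs at ha with h
    · exact h ▸ hS a.2
    · simp at ha
  · rw [← Ideal.Quotient.eq, ← hl, Finsupp.sum, Finsupp.sum, map_sum]
    exact Finset.sum_congr rfl fun a _ => (map_smul (Ideal.Quotient.mkₐ ℚ I) (l a) (mon a.1)).symm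

/-- Reduction modulo `I` is carried over to `J` one degree at a time, from the top down, without
raising the degree. -/
theorem exists_degreeLT_sub_mem {n : ℕ} {I J : Ideal (Poly n)} {S : Set (Fin n →₀ ℕ)}
    (hS : standardMonomials I ⊆ S) (hI : ∀ f ∈ I, ComponentsLift J f) (d : ℕ) (p : Poly n)
    (hp : DegreeLT d p) :
    ∃ v : Poly n, (∀ m ∈ v.support, m ∈ S) ∧ DegreeLT d v ∧ p - v ∈ J := by
  induction d generalizing p with
  | zero =>
    obtain rfl : p = 0 := by
      ext m
      exact hp m (Nat.zero_le _)
    exact ⟨0, by simp, fun m _ => by simp, by simp⟩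
  | succ d ih =>
    obtain ⟨v, hv, hpv⟩ := exists_sub_mem_of_standardMonomials_subset hS p
    obtain ⟨q, hq, hqd⟩ := hI _ hpv d
    -- `q` agrees in degree `d` with `p - v`, so subtracting it together with the degree `d` part of
    -- `v` cancels the top of `p`.
    obtain ⟨w, hw, hwd, hpw⟩ := ih (p - homogeneousComponent d v - q) fun m hm => by
      have h1 := hqd m hm
      rw [map_sub, coeff_sub, coeff_sub] at h1
      rw [coeff_sub, coeff_sub]
      rw [coeff_homogeneousComponent] at h1
      split_ifs at h1 with h
      · linarith
      · rw [hp m (by omega)]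
        linarith
    refine ⟨homogeneousComponent d v + w, fun m hm => ?_, fun m hm => ?_, ?_⟩
    · rcases Finset.mem_union.1 (support_add hm) with h | h
      · rw [support_homogeneousComponent] at h
        exact hv m (Finset.mem_filter.1 h).1
      · exact hw m h
    · rw [coeff_add, coeff_homogeneousComponent, if_neg (by omega), hwd m (by omega), add_zero]
    · have := J.add_mem hpw hq
      convert this using 1
      ring

/-- Each component of `f` can be completed by lower terms supported in `S` to an element of `J`;
that element is zero, hence so is its top part. -/
theorem eq_zero_of_mem_of_support_subset {n : ℕ} {I J : Ideal (Poly n)} {S : Set (Fin n →₀ ℕ)}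
    (hS : standardMonomials I ⊆ S) (hI : ∀ f ∈ I, ComponentsLift J f)
    (hJ : ∀ f ∈ J, (∀ m ∈ f.support, m ∈ S) → f = 0) {f : Poly n} (hf : f ∈ I)
    (hfS : ∀ m ∈ f.support, m ∈ S) : f = 0 := by
  have key : ∀ d, homogeneousComponent d f = 0 := by
    intro d
    obtain ⟨p, hp, hpd⟩ := hI f hf d
    obtain ⟨v, hv, hvd, hpv⟩ := exists_degreeLT_sub_mem hS hI d _ hpd
    have h0 : homogeneousComponent d f + v = 0 := by
      refine hJ _ ?_ fun m hm => ?_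
      · have := J.sub_mem hp hpv
        convert this using 1
        ring
      · rcases Finset.mem_union.1 (support_add hm) with h | h
        · rw [support_homogeneousComponent] at h
          exact hfS m (Finset.mem_filter.1 h).1
        · exact hv m h
    ext m
    by_cases hm : m.degree = d
    · have := congrArg (coeff m) h0
      rwa [coeff_add, hvd m hm.ge, add_zero] at this
    · rw [coeff_homogeneousComponent, if_neg hm, coeff_zero]
  rw [← sum_homogeneousComponent f]
  exact Finset.sum_eq_zero fun d _ => key d

theorem subStaircaseMonomials_subset_standardMonomials (n k r : ℕ) (hr : r ≤ n) :
    subStaircaseMonomials n k r ⊆ standardMonomials (idealI n k r) := by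
  have hsub : standardMonomials (idealI n k r) ⊆ subStaircaseMonomials n k r :=
    (standardMonomials_subset_goodMonomials n k r).trans
      (goodMonomials_subset_subStaircaseMonomials n k r hr)
  obtain ⟨A, hA⟩ := Infinite.exists_subset_card_eq ℚ (n + k)
  obtain ⟨L, hLA, hL⟩ := Finset.exists_subset_card_eq (show r ≤ A.card by omega)
  intro a ha
  by_contra hna
  obtain ⟨v, hv, hav⟩ := exists_sub_mem_of_standardMonomials_subset
    (subset_refl (standardMonomials (idealI n k r))) (mon a)
  -- Both `a` and the standard monomials of `v` lie below staircases, so this element of the ideal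
  -- must vanish, which forces `a` itself to be standard.
  have h0 : mon a - v = 0 := by
    refine eq_zero_of_mem_of_support_subset hsub
      (fun f hf => componentsLift_of_mem_idealI hA hL hf) ?_ hav fun m hm => ?_
    · intro f hf hfS
      rw [mem_vanishingIdeal_iff] at hf
      exact eq_zero_of_eval_pointLocus hLA hA hL
        (fun m hm => belowStaircase_of_mem hr (hfS m hm)) fun y hy => by simpa using hf y hy
    · rcases Finset.mem_union.1 (support_sub (Fin n) _ _ hm) with h | h
      · rw [support_monomial, if_neg one_ne_zero, Finset.mem_singleton] at h
        exact h ▸ ha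
      · exact hsub (hv m h)
  have h1 : a ∈ v.support := by
    rw [← sub_eq_zero.1 h0, mem_support_iff, coeff_monomial, if_pos rfl]
    exact one_ne_zero
  exact hna (hv a h1)

end TailPositive

theorem mainTheorem8 (n k r : ℕ) (hr : r ≤ n) :
    TailPositive.standardMonomials (TailPositive.idealI n k r) =
        TailPositive.goodMonomials n k r ∧
      TailPositive.standardMonomials (TailPositive.idealI n k r) =
        TailPositive.subStaircaseMonomials n k r := by
  have h1 := TailPositive.standardMonomials_subset_goodMonomials n k r
  have h2 := TailPositive.goodMonomials_subset_subStaircaseMonomials n k r hr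
  have h3 := TailPositive.subStaircaseMonomials_subset_standardMonomials n k r hr
  exact ⟨h1.antisymm (h2.trans h3), (h1.trans h2).antisymm h3⟩
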